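/- Let $\ell\ge 0$ and $k\ge 1$ be integers, let $p_1,\dots,p_k$ be (not necessarily distinct) primes, and let $\psi:\mathbb{N}\to\mathbb{R}$ be a non-negative function on the positive integers. Let $\lambda$ be Lebesgue measure on $\mathbb{R}/\mathbb{Z}$, let $\mu_p$ be the Haar probability measure on $\mathbb{Z}_p$, and put on $X=(\mathbb{R}/\mathbb{Z})^{\ell}\times\mathbb{Z}_{p_1}\times\cdots\times\mathbb{Z}_{p_k}$ the product probability measure $\mu=\lambda^{\ell}\times\mu_{p_1}\times\cdots\times\mu_{p_k}$. Write $\|x\|$ for the distance from $x$ to the nearest integer. For $n\ge 1$ let $\mathcal{E}_n(\psi)\subseteq X$ be the set of all $(x_1,\dots,x_{\ell+k})\in X$ for which there are integers $a_1,\dots,a_{\ell+k}$ with $-n\le a_j\le n$ and $\gcd(a_j,n)=1$ for every $j$, such that $$\max\Big\{\Big\|x_1-\frac{a_1}{n}\Big\|,\dots,\Big\|x_\ell-\frac{a_\ell}{n}\Big\|,\Big|x_{\ell+1}-\frac{a_{\ell+1}}{n}\Big|_{p_1},\dots,\Big|x_{\ell+k}-\frac{a_{\ell+k}}{n}\Big|_{p_k}\Big\}\le\psi(n),$$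 and let $W_{\ell,p_1,\dots,p_k}(\psi)$ be the set of all $x\in X$ that lie in $\mathcal{E}_n(\psi)$ for infinitely many $n\in\mathbb{N}$. Then $$\mu\big(W_{\ell,p_1,\dots,p_k}(\psi)\big)=0\quad\text{or}\quad\mu\big(W_{\ell,p_1,\dots,p_k}(\psi)\big)=1.$$ -/

import Mathlib

open MeasureTheory

noncomputable section

namespace MixedApprox

/-- The Borel `σ`-algebra on `ℤ_p`. -/
instance instMeasurableSpacePadicInt (p : ℕ) [Fact p.Prime] : MeasurableSpace ℤ_[p] :=
  borel ℤ_[p]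

instance instBorelSpacePadicInt (p : ℕ) [Fact p.Prime] : BorelSpace ℤ_[p] := ⟨rfl⟩

/-- The Haar probability measure `μ_p` on the compact additive group `ℤ_p`. -/
def padicHaar (p : ℕ) [Fact p.Prime] : Measure ℤ_[p] := Measure.addHaarMeasure ⊤

instance instIsAddHaarMeasurePadicHaar (p : ℕ) [Fact p.Prime] :
    (padicHaar p).IsAddHaarMeasure := by
  unfold padicHaar
  infer_instance

instance instIsProbabilityMeasurePadicHaar (p : ℕ) [Fact p.Prime] :
    IsProbabilityMeasure (padicHaar p) :=
  ⟨by unfold padicHaar; exact Measure.addHaarMeasure_self⟩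

/-- The space `(ℝ/ℤ)^ℓ × ℤ_{p_1} × ⋯ × ℤ_{p_k}`. -/
abbrev Space (ℓ : ℕ) {k : ℕ} (p : Fin k → ℕ) [∀ i, Fact (p i).Prime] : Type :=
  (Fin ℓ → UnitAddCircle) × ((i : Fin k) → ℤ_[p i])

/-- The product probability measure `λ^ℓ × μ_{p_1} × ⋯ × μ_{p_k}`. -/
def mixedMeasure (ℓ : ℕ) {k : ℕ} (p : Fin k → ℕ) [∀ i, Fact (p i).Prime] :
    Measure (Space ℓ p) :=
  (Measure.pi fun _ : Fin ℓ => (volume : Measure UnitAddCircle)).prod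
    (Measure.pi fun i : Fin k => padicHaar (p i))

/-- The norm `max {‖x_1‖, …, ‖x_ℓ‖, |y_1|_{p_1}, …, |y_k|_{p_k}}` on
`(ℝ/ℤ)^ℓ × ℚ_{p_1} × ⋯ × ℚ_{p_k}`. Here the norm on `UnitAddCircle` is the distance to the
nearest integer, and Mathlib's norm on a finite product is the maximum of the norms of the
coordinates (and `0` on the empty product). -/
def mixedNorm {ℓ k : ℕ} {p : Fin k → ℕ} [∀ i, Fact (p i).Prime]
    (x : Fin ℓ → UnitAddCircle) (y : (i : Fin k) → ℚ_[p i]) : ℝ :=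
  max ‖x‖ ‖y‖

/-- The admissible numerators for the denominator `n`: integers `a` with `-n ≤ a ≤ n` and
`gcd(a, n) = 1`. -/
def numerators (n : ℕ) : Set ℤ :=
  {a | -(n : ℤ) ≤ a ∧ a ≤ n ∧ Int.gcd a n = 1}

/-- The set `E_n^{ℓ, p_1, …, p_k}(ψ)` (meaningful for `n ≥ 1`): all points `(x, y)` for which
there are admissible numerators `a_1, …, a_ℓ`, `b_1, …, b_k` such that
`|(x_1 - a_1/n, …, x_ℓ - a_ℓ/n, y_1 - b_1/n, …, y_k - b_k/n)| ≤ ψ(n)`. -/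
def approxSet (ℓ : ℕ) {k : ℕ} (p : Fin k → ℕ) [∀ i, Fact (p i).Prime] (ψ : ℕ → ℝ) (n : ℕ) :
    Set (Space ℓ p) :=
  {z | ∃ a : Fin ℓ → ℤ, ∃ b : Fin k → ℤ,
    (∀ j, a j ∈ numerators n) ∧ (∀ i, b i ∈ numerators n) ∧
    mixedNorm (fun j => z.1 j - (((a j : ℝ) / (n : ℝ) : ℝ) : UnitAddCircle))
      (fun i => (z.2 i : ℚ_[p i]) - (b i : ℚ_[p i]) / (n : ℚ_[p i])) ≤ ψ n}

/-- The set `W_{ℓ, p_1, …, p_k}(ψ)` of the points that lie in `E_n^{ℓ, p_1, …, p_k}(ψ)` for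
infinitely many positive integers `n`. -/
def limsupSet (ℓ : ℕ) {k : ℕ} (p : Fin k → ℕ) [∀ i, Fact (p i).Prime] (ψ : ℕ → ℝ) :
    Set (Space ℓ p) :=
  {z | {n : ℕ | 1 ≤ n ∧ z ∈ approxSet ℓ p ψ n}.Infinite}

end MixedApprox

end

/-! This is Cassels' zero-one argument, with multiplication replaced by the digit shift on the
p-adic factors. If $\mathcal E_n$ is the whole space infinitely often, there is nothing to prove.
Otherwise, for large $n$, $\mathcal E_n$ is empty as soon as some $p_i\mid n$
(`one_le_of_dvd_of_nonempty`, `approxSet_eq_univ_of_one_le`). Along the other $n$ the radii tend to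
$0$, because Kanold's bound (`exists_coprime_add_mul`) makes admissible fractions
$\varepsilon$-dense. The limsup set is then governed by shrinking neighbourhoods of finite sets of
fractions.

Fix $q$ among the $p_i$ and let $T_m$ multiply the circles by $q^m$ and delete $m$ digits in each
$\mathbb Z_{p_i}$. It preserves $\mu$ and sends admissible fractions to admissible fractions,
enlarging small radii at most by a constant factor (`expand_mem_cthickening`). Such a factor changes
the limsup set $W$ only by a null set, since $\mu$ is doubling, so $T_m^{-1}W=W$ almost everywhere
(`preimage_expand_wellApprox_ae_eq`). For $g$ in a dense set, $T_m(g+x)=T_m(x)$ outside a set whose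
measure tends to $0$. Hence $W$ is almost invariant under a dense set of translations, and so null
or conull (`eventuallyConst_of_preimage_ae_eq`). -/

noncomputable section

namespace MixedApprox

/-! ### Integers coprime to `n` in short arithmetic progressions -/

/-- An exponential sum with `s.card` terms that vanishes at the first `s.card` natural numbers
vanishes at all of them. -/
theorem sum_mul_pow_eq_zero_of_forall_lt_card {ι K : Type*} [Field K] (s : Finset ι)
    (c w : ι → K) (h : ∀ j < s.card, ∑ i ∈ s, c i * w i ^ j = 0) (j : ℕ) :
    ∑ i ∈ s, c i * w i ^ j = 0 := by
  set P : Polynomial K := ∏ i ∈ s, (Polynomial.X - Polynomial.C (w i)) with hP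
  have hmonic : P.Monic := Polynomial.monic_prod_X_sub_C w s
  have hdeg : P.natDegree = s.card := Polynomial.natDegree_finsetProd_X_sub_C_eq_card s w
  -- Every `w i` is a root of `P`, so `X ^ j` may be replaced by its remainder, which involves only
  -- exponents below `s.card`.
  set R : Polynomial K := Polynomial.X ^ j %ₘ P with hR
  have heval : ∀ i ∈ s, w i ^ j = R.eval (w i) := by
    intro i hi
    have hroot : P.eval (w i) = 0 := by
      rw [hP, Polynomial.eval_prod]
      exact Finset.prod_eq_zero hi (by simp)
    have := congrArg (Polynomial.eval (w i)) (Polynomial.modByMonic_add_div (Polynomial.X ^ j) P)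
    simpa [hroot] using this.symm
  have hsum : ∀ i ∈ s, c i * w i ^ j = ∑ k ∈ Finset.range s.card, R.coeff k * (c i * w i ^ k) := by
    intro i hi
    have hRdeg : R.natDegree < s.card := by
      have hne : P ≠ 1 := fun h1 => by
        rw [h1, Polynomial.natDegree_one] at hdeg
        exact (Finset.card_pos.2 ⟨i, hi⟩).ne hdeg
      have := Polynomial.natDegree_modByMonic_lt (Polynomial.X ^ j : Polynomial K) hmonic hne
      rwa [hdeg] at this
    rw [heval i hi, Polynomial.eval_eq_sum_range' hRdeg, Finset.mul_sum]
    refine Finset.sum_congr rfl fun k hk => ?_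
    ring
  rw [Finset.sum_congr rfl hsum, Finset.sum_comm]
  refine Finset.sum_eq_zero fun k hk => ?_
  rw [← Finset.mul_sum, h k (Finset.mem_range.1 hk), mul_zero]

/-- Kanold's bound: among `2 ^ ω(n)` consecutive terms of an arithmetic progression whose step is
coprime to `n`, one is coprime to `n`. -/
theorem exists_coprime_add_mul {n P : ℕ} (hn : n ≠ 0) (hP : P.Coprime n) (r : ℕ) :
    ∃ j < 2 ^ n.primeFactors.card, (r + P * j).Coprime n := by
  by_contra! hcon
  have hζ : ∀ q : ℕ, ∃ ζ : ℂ, q ≠ 0 → IsPrimitiveRoot ζ q := fun q =>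
    ⟨_, Complex.isPrimitiveRoot_exp q⟩
  choose ζ hζ using hζ
  have hroot : ∀ q ∈ n.primeFactors, ∀ a : ℕ, ζ q ^ a = 1 ↔ q ∣ a := fun q hq a =>
    (hζ q (Nat.prime_of_mem_primeFactors hq).ne_zero).pow_eq_one_iff_dvd a
  -- The product vanishes exactly when `r + P * j` shares a prime with `n`; expanded, it is an
  -- exponential sum in `j` with `2 ^ ω(n)` terms.
  have hexp : ∀ j : ℕ, ∏ q ∈ n.primeFactors, (1 - ζ q ^ (r + P * j)) =
      ∑ S ∈ n.primeFactors.powerset, (∏ q ∈ S, -ζ q ^ r) * (∏ q ∈ S, ζ q ^ P) ^ j := by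
    intro j
    simp_rw [sub_eq_add_neg]
    rw [Finset.prod_one_add]
    refine Finset.sum_congr rfl fun S _ => ?_
    rw [← Finset.prod_pow, ← Finset.prod_mul_distrib]
    refine Finset.prod_congr rfl fun q _ => ?_
    rw [pow_add, pow_mul]
    ring
  have hzero : ∀ j < n.primeFactors.powerset.card,
      ∑ S ∈ n.primeFactors.powerset, (∏ q ∈ S, -ζ q ^ r) * (∏ q ∈ S, ζ q ^ P) ^ j = 0 := by
    intro j hj
    rw [Finset.card_powerset] at hj
    obtain ⟨q, hq, hqr, hqn⟩ := Nat.Prime.not_coprime_iff_dvd.1 (hcon j hj)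
    have hmem : q ∈ n.primeFactors := Nat.mem_primeFactors.2 ⟨hq, hqn, hn⟩
    rw [← hexp]
    exact Finset.prod_eq_zero hmem (by rw [(hroot q hmem _).2 hqr, sub_self])
  obtain ⟨j, hj⟩ : ∃ j : ℕ, (r + P * j).Coprime n := by
    have : NeZero n := ⟨hn⟩
    have hu : IsUnit (P : ZMod n) := (ZMod.isUnit_iff_coprime P n).2 hP
    obtain ⟨u, hu⟩ := hu
    refine ⟨((↑u⁻¹ * (1 - r) : ZMod n)).val, ?_⟩
    rw [← ZMod.isUnit_iff_coprime]
    push_cast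
    rw [ZMod.natCast_zmod_val, ← hu]
    simp
  have := sum_mul_pow_eq_zero_of_forall_lt_card _ _ _ hzero j
  rw [← hexp, Finset.prod_eq_zero_iff] at this
  obtain ⟨q, hq, h0⟩ := this
  have hdvd : q ∣ r + P * j := (hroot q hq _).1 (sub_eq_zero.1 h0).symm
  exact Nat.Prime.not_coprime_iff_dvd.2
    ⟨q, Nat.prime_of_mem_primeFactors hq, hdvd, Nat.dvd_of_mem_primeFactors hq⟩ hj

/-- Each prime factor `q ≥ 4` pays for its own factor 4, while 2 and 3 need only an extra factor 2.
The bound amounts to `2 ^ ω(n) = O(√n)`. -/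
theorem four_pow_card_primeFactors_le {n : ℕ} (hn : n ≠ 0) :
    4 ^ n.primeFactors.card ≤ 16 * n := by
  have hsmall : ((n.primeFactors.filter (· < 4)).card) ≤ 4 := by
    refine (Finset.card_le_card (t := Finset.range 4) fun q hq => ?_).trans_eq (Finset.card_range 4)
    exact Finset.mem_range.2 (Finset.mem_filter.1 hq).2
  calc 4 ^ n.primeFactors.card = ∏ _q ∈ n.primeFactors, 4 := (Finset.prod_const 4).symm
    _ ≤ ∏ q ∈ n.primeFactors, ((if q < 4 then 2 else 1) * q) := by
        refine Finset.prod_le_prod' fun q hq => ?_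
        have := (Nat.prime_of_mem_primeFactors hq).two_le
        split_ifs <;> omega
    _ = 2 ^ (n.primeFactors.filter (· < 4)).card * ∏ q ∈ n.primeFactors, q := by
        rw [Finset.prod_mul_distrib, ← Finset.prod_filter, Finset.prod_const]
    _ ≤ 2 ^ 4 * n := Nat.mul_le_mul (Nat.pow_le_pow_right two_pos hsmall)
        (Nat.le_of_dvd (Nat.pos_of_ne_zero hn) (Nat.prod_primeFactors_dvd n))
    _ = 16 * n := by norm_num

/-- `2 ^ ω(n)` is eventually smaller than any fixed multiple of `n`. -/
theorem eventually_mul_two_pow_card_primeFactors_le (C : ℕ) :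
    ∀ᶠ n : ℕ in Filter.atTop, C * 2 ^ n.primeFactors.card ≤ n := by
  filter_upwards [Filter.eventually_ge_atTop (16 * C ^ 2), Filter.eventually_ne_atTop 0] with n hn h0
  have h4 := four_pow_card_primeFactors_le h0
  have h5 : (2 ^ n.primeFactors.card) ^ 2 ≤ 16 * n := by
    rw [← pow_mul, mul_comm, pow_mul]; exact h4
  refine le_of_not_gt fun hlt => ?_
  have : n ^ 2 < n ^ 2 := calc
    n ^ 2 < (C * 2 ^ n.primeFactors.card) ^ 2 := Nat.pow_lt_pow_left hlt two_ne_zero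
    _ = C ^ 2 * (2 ^ n.primeFactors.card) ^ 2 := by ring
    _ ≤ C ^ 2 * (16 * n) := Nat.mul_le_mul_left _ h5
    _ = (16 * C ^ 2) * n := by ring
    _ ≤ n * n := Nat.mul_le_mul_right _ hn
    _ = n ^ 2 := by ring
  exact this.false

open Filter Set Topology

/-! ### Measure preservation and a zero-one criterion on compact groups -/

section CompactGroup

variable {G : Type*} [AddCommGroup G] [TopologicalSpace G] [IsTopologicalAddGroup G]
  [CompactSpace G] [MeasurableSpace G] [BorelSpace G]

/-- A measurable self-map of a compact group that turns suitable translations into arbitrary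
prescribed translations preserves the Haar probability measure. -/
theorem measurePreserving_of_exists_add (μ : Measure G) [IsProbabilityMeasure μ]
    [μ.IsAddHaarMeasure] {T : G → G} (hT : Measurable T)
    (h : ∀ z, ∃ w, ∀ x, T (w + x) = z + T x) : MeasurePreserving T μ μ := by
  refine ⟨hT, ?_⟩
  have hprob : IsProbabilityMeasure (μ.map T) := Measure.isProbabilityMeasure_map hT.aemeasurable
  have hinv : (μ.map T).IsAddLeftInvariant := by
    refine ⟨fun z => ?_⟩
    obtain ⟨w, hw⟩ := h z
    rw [Measure.map_map (measurable_const_add z) hT]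
    have : (fun x => z + x) ∘ T = T ∘ fun x => w + x := by
      ext x
      simp [hw]
    rw [this, ← Measure.map_map hT (measurable_const_add w), map_add_left_eq_self]
  have hhaar : (μ.map T).IsAddHaarMeasure :=
    Measure.isAddHaarMeasure_of_isCompact_nonempty_interior (μ.map T) univ isCompact_univ
      (by simp) (by simp) (by simp)
  exact Measure.isAddHaarMeasure_eq_of_isProbabilityMeasure _ _

/-- Let `T m` be self-maps of a compact group such that a dense set of translations is, up to small
sets, absorbed by `T m` for large `m`. Then a set that is almost invariant under every `T m` is null
or conull. -/
theorem eventuallyConst_of_preimage_ae_eq [SecondCountableTopology G] (μ : Measure G) [IsProbabilityMeasure μ]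
    [μ.IsAddHaarMeasure] {T : ℕ → G → G}
    {D : Set G} (hD : Dense D)
    (hDT : ∀ g ∈ D, Tendsto (fun m => μ {x | T m (g + x) ≠ T m x}) atTop (𝓝 0))
    {W : Set G} (hW : MeasurableSet W) (hTW : ∀ m, T m ⁻¹' W =ᵐ[μ] W) :
    EventuallyConst W (ae μ) := by
  refine aeconst_of_dense_setOfPred_preimage_vadd_ae (M := G) hW.nullMeasurableSet
    (hD.mono fun g hg => ?_)
  simp only [vadd_eq_add, mem_ofPred_eq]
  rw [← measure_symmDiff_eq_zero_iff]
  refine le_antisymm (ge_of_tendsto' (hDT g hg) fun m => ?_) zero_le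
  have hpre : (fun x => g + x) ⁻¹' (T m ⁻¹' W) =ᵐ[μ] (fun x => g + x) ⁻¹' W :=
    (measurePreserving_add_left μ g).quasiMeasurePreserving.preimage_ae_eq (hTW m)
  -- Replacing `W` by `T m ⁻¹' W` is free; the symmetric difference then lies where `T m (g + x)`
  -- and `T m x` differ.
  rw [← measure_congr (hpre.symmDiff (hTW m))]
  refine measure_mono fun x hx heq => ?_
  rw [mem_symmDiff, mem_preimage, mem_preimage, mem_preimage, heq] at hx
  tauto

end CompactGroup

/-! ### The digit shift and Haar measure on the p-adic integers -/

section Shift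

variable {p : ℕ} [Fact p.Prime]

theorem exists_eq_residue_add (m : ℕ) (x : ℤ_[p]) :
    ∃ z, x = ((PadicInt.toZModPow m x).val : ℤ_[p]) + p ^ m * z := by
  have h : x - ((PadicInt.toZModPow m x).val : ℤ_[p]) ∈ RingHom.ker (PadicInt.toZModPow (p := p) m) := by
    rw [RingHom.mem_ker, map_sub, map_natCast, ZMod.natCast_zmod_val, sub_self]
  rw [PadicInt.ker_toZModPow, Ideal.mem_span_singleton] at h
  obtain ⟨z, hz⟩ := h
  exact ⟨z, by rw [← hz]; ring⟩

/-- The `m`-fold digit shift on `ℤ_p`, deleting the `m` lowest digits. -/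
def shift (m : ℕ) (x : ℤ_[p]) : ℤ_[p] := (exists_eq_residue_add m x).choose

theorem residue_add_pow_mul_shift (m : ℕ) (x : ℤ_[p]) :
    ((PadicInt.toZModPow m x).val : ℤ_[p]) + p ^ m * shift m x = x :=
  (exists_eq_residue_add m x).choose_spec.symm

theorem prime_pow_ne_zero (m : ℕ) : (p : ℤ_[p]) ^ m ≠ 0 :=
  pow_ne_zero _ (Nat.cast_ne_zero.2 (Fact.out : p.Prime).ne_zero)

theorem shift_eq_of_eq {m : ℕ} {x z : ℤ_[p]} {s : ℕ} (hs : s < p ^ m) (h : x = s + p ^ m * z) :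
    shift m x = z := by
  have hres : PadicInt.toZModPow m x = s := by
    have h0 : PadicInt.toZModPow m ((p : ℤ_[p]) ^ m * z) = 0 := by
      rw [← RingHom.mem_ker, PadicInt.ker_toZModPow]
      exact Ideal.mul_mem_right _ _ (Ideal.mem_span_singleton_self _)
    rw [h, map_add, h0, map_natCast, add_zero]
  have := residue_add_pow_mul_shift m x
  rw [hres, ZMod.val_natCast_of_lt hs] at this
  exact mul_left_cancel₀ (prime_pow_ne_zero m) (add_left_cancel (this.trans h))

/-- Adding a multiple of `p ^ m` leaves the lowest `m` digits alone. This equivariance yields both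
continuity and measure preservation. -/
theorem shift_add_pow_mul (m : ℕ) (x z : ℤ_[p]) : shift m ((p : ℤ_[p]) ^ m * z + x) = z + shift m x := by
  refine shift_eq_of_eq (ZMod.val_lt (PadicInt.toZModPow m x)) ?_
  conv_lhs => rw [← residue_add_pow_mul_shift m x]
  ring

/-- The hypothesis says that the addition carries nothing beyond the lowest `m` digits. -/
theorem shift_natCast_add {m N : ℕ} {x : ℤ_[p]} (h : N + (PadicInt.toZModPow m x).val < p ^ m) :
    shift m ((N : ℤ_[p]) + x) = shift m x := by
  refine shift_eq_of_eq h ?_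
  conv_lhs => rw [← residue_add_pow_mul_shift m x]
  push_cast
  ring

theorem norm_le_zpow_iff_exists (m : ℕ) (x : ℤ_[p]) :
    ‖x‖ ≤ ((p : ℝ) ^ m)⁻¹ ↔ ∃ z, x = p ^ m * z := by
  have := PadicInt.norm_le_pow_iff_mem_span_pow x m
  rw [zpow_neg, zpow_natCast, Ideal.mem_span_singleton] at this
  exact this

theorem continuous_shift (m : ℕ) : Continuous (shift m : ℤ_[p] → ℤ_[p]) := by
  have hp0 : (0 : ℝ) < (p : ℝ) ^ m := pow_pos (Nat.cast_pos.2 (Fact.out : p.Prime).pos) m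
  rw [Metric.continuous_iff]
  intro x ε hε
  refine ⟨min ((p : ℝ) ^ m)⁻¹ (((p : ℝ) ^ m)⁻¹ * ε), by positivity, fun y hy => ?_⟩
  rw [dist_eq_norm] at hy ⊢
  obtain ⟨z, hz⟩ := (norm_le_zpow_iff_exists m (y - x)).1 (hy.le.trans (min_le_left _ _))
  have hyx : y = p ^ m * z + x := by rw [← hz]; ring
  have hlt := hy.trans_le (min_le_right _ _)
  rw [hz, norm_mul, norm_pow, PadicInt.norm_p, inv_pow] at hlt
  rw [hyx, shift_add_pow_mul, add_sub_cancel_right]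
  exact lt_of_mul_lt_mul_left hlt (by positivity)

theorem measurePreserving_shift (m : ℕ) :
    MeasurePreserving (shift m : ℤ_[p] → ℤ_[p]) (padicHaar p) (padicHaar p) :=
  measurePreserving_of_exists_add _ (continuous_shift m).measurable
    fun z => ⟨p ^ m * z, fun x => shift_add_pow_mul m x z⟩

theorem padicHaar_closedBall (x : ℤ_[p]) (r : ℝ) :
    padicHaar p (Metric.closedBall x r) = padicHaar p (Metric.closedBall 0 r) := by
  have : (fun y => -x + y) ⁻¹' Metric.closedBall (0 : ℤ_[p]) r = Metric.closedBall x r := by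
    ext y
    simp [dist_eq_norm, sub_eq_neg_add]
  rw [← this, measure_preimage_add]

/-- The preimage of the large ball under the one-digit shift is covered by `p` small balls, one
about each digit. This is the doubling estimate. -/
theorem padicHaar_closedBall_prime_mul_le (r : ℝ) :
    padicHaar p (Metric.closedBall 0 (p * r)) ≤ p * padicHaar p (Metric.closedBall 0 r) := by
  have hp0 : (0 : ℝ) < p := Nat.cast_pos.2 (Fact.out : p.Prime).pos
  rw [← (measurePreserving_shift 1).measure_preimage
    Metric.isClosed_closedBall.measurableSet.nullMeasurableSet]
  have hsub : shift 1 ⁻¹' Metric.closedBall (0 : ℤ_[p]) (p * r) ⊆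
      ⋃ s ∈ Finset.range p, Metric.closedBall (s : ℤ_[p]) r := by
    intro x hx
    have hval := ZMod.val_lt (PadicInt.toZModPow 1 x)
    simp only [mem_iUnion, Finset.mem_range]
    refine ⟨(PadicInt.toZModPow 1 x).val, by simpa using hval, ?_⟩
    rw [mem_preimage, mem_closedBall_zero_iff] at hx
    rw [Metric.mem_closedBall, dist_eq_norm]
    rw [sub_eq_of_eq_add' (residue_add_pow_mul_shift 1 x).symm, norm_mul, norm_pow, PadicInt.norm_p, pow_one]
    rwa [inv_mul_le_iff₀ hp0]
  refine (measure_mono hsub).trans ((measure_biUnion_finset_le _ _).trans ?_)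
  simp [padicHaar_closedBall]

instance instIsUnifLocDoublingMeasurePadicHaar (p : ℕ) [Fact p.Prime] :
    IsUnifLocDoublingMeasure (padicHaar p) := by
  refine ⟨p, ?_⟩
  filter_upwards [self_mem_nhdsWithin] with ε hε x
  rw [padicHaar_closedBall, padicHaar_closedBall x]
  have h2 : (2 : ℝ) ≤ p := by exact_mod_cast (Fact.out : p.Prime).two_le
  refine (measure_mono (Metric.closedBall_subset_closedBall ?_)).trans
    ((padicHaar_closedBall_prime_mul_le ε).trans_eq (by simp))
  exact mul_le_mul_of_nonneg_right h2 (le_of_lt hε)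

/-- The point 0 is not isolated, so Haar measure has no atom there, and the balls shrink to it. -/
theorem tendsto_padicHaar_closedBall :
    Tendsto (fun m : ℕ => padicHaar p (Metric.closedBall 0 ((p : ℝ) ^ m)⁻¹)) atTop (𝓝 0) := by
  have hp1 : (1 : ℝ) < p := by exact_mod_cast (Fact.out : p.Prime).one_lt
  have hlim : Tendsto (fun m : ℕ => ((p : ℝ) ^ m)⁻¹) atTop (𝓝 0) :=
    tendsto_inv_atTop_zero.comp (tendsto_pow_atTop_atTop_of_one_lt hp1)
  have hpunct : (𝓝[≠] (0 : ℤ_[p])).NeBot := by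
    have : Tendsto (fun m : ℕ => (p : ℤ_[p]) ^ m) atTop (𝓝[≠] 0) := by
      refine tendsto_nhdsWithin_iff.2 ⟨?_, Eventually.of_forall fun m => prime_pow_ne_zero m⟩
      rw [tendsto_zero_iff_norm_tendsto_zero]
      simpa using hlim
    exact this.neBot
  have h := (tendsto_measure_cthickening_of_isClosed (μ := padicHaar p)
    ⟨1, one_pos, measure_ne_top _ _⟩ (isClosed_singleton (x := (0 : ℤ_[p])))).comp hlim
  rw [measure_singleton] at h
  refine h.congr fun m => ?_
  rw [Function.comp_apply, Metric.cthickening_singleton _ (by positivity)]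

/-- A carry past digit `m` forces `x` to be within `p ^ (-m)` of one of `0, -1, …, -N`, so the
exceptional set is covered by `N + 1` small balls. -/
theorem tendsto_padicHaar_shift_natCast_add_ne (N : ℕ) :
    Tendsto (fun m => padicHaar p {x | shift m ((N : ℤ_[p]) + x) ≠ shift m x}) atTop (𝓝 0) := by
  have hsub : ∀ m, {x : ℤ_[p] | shift m ((N : ℤ_[p]) + x) ≠ shift m x} ⊆
      ⋃ i ∈ Finset.range (N + 1), Metric.closedBall (-(i : ℤ_[p])) ((p : ℝ) ^ m)⁻¹ := by
    intro m x hx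
    have hle : p ^ m ≤ N + (PadicInt.toZModPow m x).val := by
      by_contra! h
      exact hx (shift_natCast_add h)
    have hval := ZMod.val_lt (PadicInt.toZModPow m x)
    simp only [mem_iUnion, Finset.mem_range]
    refine ⟨p ^ m - (PadicInt.toZModPow m x).val, by omega, ?_⟩
    rw [Metric.mem_closedBall, dist_eq_norm, norm_le_zpow_iff_exists]
    refine ⟨1 + shift m x, ?_⟩
    rw [Nat.cast_sub hval.le]
    push_cast
    linear_combination -(residue_add_pow_mul_shift m x)
  refine tendsto_of_tendsto_of_tendsto_of_le_of_le tendsto_const_nhds ?_ (fun _ => zero_le)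
    fun m => (measure_mono (hsub m)).trans (measure_biUnion_finset_le _ _)
  simp only [padicHaar_closedBall, Finset.sum_const]
  simp only [nsmul_eq_mul]
  have := ENNReal.Tendsto.const_mul (tendsto_padicHaar_closedBall (p := p))
    (Or.inr (ENNReal.natCast_ne_top (Finset.range (N + 1)).card))
  rwa [mul_zero] at this

/-- The digit shift maps the neighbourhood of a fraction `b / n` with `|b| ≤ n` and `gcd(b, n) = 1`
to the neighbourhood of another such fraction. -/
theorem exists_numerator_shift {m n : ℕ} {x c : ℤ_[p]} {b : ℤ} (hb : b ∈ numerators n)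
    (hc : n * c = b) (hx : ‖x - c‖ ≤ ((p : ℝ) ^ m)⁻¹) :
    ∃ b' ∈ numerators n, ∃ c' : ℤ_[p], n * c' = b' ∧ ‖shift m x - c'‖ = p ^ m * ‖x - c‖ := by
  have hp0 : (0 : ℝ) < (p : ℝ) ^ m := pow_pos (Nat.cast_pos.2 (Fact.out : p.Prime).pos) m
  obtain ⟨hb1, hb2, hb3⟩ := hb
  set s := (PadicInt.toZModPow m x).val with hs
  have hval : s < p ^ m := ZMod.val_lt (PadicInt.toZModPow m x)
  have hsx := residue_add_pow_mul_shift m x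
  rw [← hs] at hsx
  obtain ⟨d, hd⟩ := (norm_le_zpow_iff_exists m (x - c)).1 hx
  have hcs : c = s + p ^ m * (shift m x - d) := by
    rw [mul_sub, ← hd, ← add_sub_assoc, hsx, sub_sub_cancel]
  -- Since `c` and `x` share their lowest `m` digits `s`, shifting `c` gives `(b - n * s) / p ^ m`
  -- over `n`; this is the new numerator `b'`.
  have hdvd : ((p ^ m : ℕ) : ℤ) ∣ b - n * s := by
    push_cast
    rw [← PadicInt.pow_p_dvd_int_iff]
    refine ⟨n * (shift m x - d), ?_⟩
    push_cast
    rw [← hc]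
    conv_lhs => rw [hcs]
    ring
  obtain ⟨b', hb'⟩ := hdvd
  have hbeq : b = (p ^ m : ℕ) * b' + n * s := by linarith
  refine ⟨b', ⟨?_, ?_, ?_⟩, shift m x - d, ?_, ?_⟩
  -- From `s ≤ p ^ m - 1` and `b ≥ -n` one gets `b - n * s ≥ -n * p ^ m`: the range `[-n, n]` is
  -- stable under the shift.
  · have hP : (0 : ℤ) < (p ^ m : ℕ) := by exact_mod_cast (pow_pos (Fact.out : p.Prime).pos m)
    have hs1 : (s : ℤ) + 1 ≤ (p ^ m : ℕ) := by exact_mod_cast hval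
    refine le_of_mul_le_mul_left ?_ hP
    nlinarith [mul_le_mul_of_nonneg_left hs1 (Int.natCast_nonneg n)]
  · have hP : (0 : ℤ) < (p ^ m : ℕ) := by exact_mod_cast (pow_pos (Fact.out : p.Prime).pos m)
    refine le_of_mul_le_mul_left ?_ hP
    nlinarith [mul_nonneg (Int.natCast_nonneg n) (Int.natCast_nonneg s),
      mul_le_mul_of_nonneg_right (Int.add_one_le_iff.2 hP) (Int.natCast_nonneg n)]
  · rw [← Int.isCoprime_iff_gcd_eq_one] at hb3 ⊢
    rw [hbeq] at hb3
    exact (IsCoprime.of_add_mul_left_left hb3).of_mul_left_right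
  · refine mul_left_cancel₀ (prime_pow_ne_zero (p := p) m) ?_
    have : ((p : ℤ_[p]) ^ m) * b' = b - n * s := by
      rw [hbeq]
      push_cast
      ring
    rw [this, ← hc]
    conv_rhs => rw [hcs]
    ring
  · rw [sub_sub_cancel, hd, norm_mul, norm_pow, PadicInt.norm_p, inv_pow]
    field_simp

/-- Points of `ℤ_p` are close to fractions with large admissible denominators prime to `p`. -/
theorem eventually_forall_exists_padic_near {ε : ℝ} (hε : 0 < ε) :
    ∀ᶠ n : ℕ in atTop, ¬ p ∣ n → ∀ x : ℤ_[p],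
      ∃ b ∈ numerators n, ‖(x : ℚ_[p]) - (b : ℚ_[p]) / (n : ℚ_[p])‖ ≤ ε := by
  obtain ⟨m, hm⟩ := PadicInt.exists_pow_neg_lt p hε
  rw [zpow_neg, zpow_natCast] at hm
  filter_upwards [eventually_mul_two_pow_card_primeFactors_le (p ^ m), eventually_ne_atTop 0]
    with n hn hn0 hpn x
  have hcop : (p ^ m).Coprime n :=
    Nat.Coprime.pow_left m (((Fact.out : p.Prime).coprime_iff_not_dvd).2 hpn)
  have hval := ZMod.val_lt (PadicInt.toZModPow m ((n : ℤ_[p]) * x))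
  have hsx := residue_add_pow_mul_shift m ((n : ℤ_[p]) * x)
  set s := (PadicInt.toZModPow m ((n : ℤ_[p]) * x)).val
  -- The numerator must be congruent to `n * x` modulo `p ^ m`; Kanold's bound finds one in this
  -- residue class that is small enough to be at most `n`.
  obtain ⟨j, hj, hcj⟩ := exists_coprime_add_mul hn0 hcop s
  have hle : s + p ^ m * j ≤ n := calc
    s + p ^ m * j ≤ p ^ m * (j + 1) := by rw [mul_add]; omega
    _ ≤ p ^ m * 2 ^ n.primeFactors.card := Nat.mul_le_mul_left _ hj
    _ ≤ n := hn
  refine ⟨((s + p ^ m * j : ℕ) : ℤ), ⟨by omega, by exact_mod_cast hle, by rwa [Int.gcd_natCast_natCast]⟩, ?_⟩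
  have hn1 : ‖(n : ℚ_[p])‖ = 1 := by
    have : ‖(n : ℤ_[p])‖ = 1 := PadicInt.norm_natCast_eq_one_iff.2
      (((Fact.out : p.Prime).coprime_iff_not_dvd).2 hpn)
    simpa [PadicInt.norm_def] using this
  have hnq : (n : ℚ_[p]) ≠ 0 := by exact_mod_cast hn0
  have hnorm : ‖(n * x - ((s + p ^ m * j : ℕ) : ℤ_[p]) : ℤ_[p])‖ ≤ ε := by
    refine le_trans ((norm_le_zpow_iff_exists m _).2 ⟨shift m ((n : ℤ_[p]) * x) - j, ?_⟩) hm.le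
    conv_lhs => rw [← hsx]
    push_cast
    ring
  rw [PadicInt.norm_def] at hnorm
  have heq : (x : ℚ_[p]) - (((s + p ^ m * j : ℕ) : ℤ) : ℚ_[p]) / (n : ℚ_[p]) =
      ((n * x - ((s + p ^ m * j : ℕ) : ℤ_[p]) : ℤ_[p]) : ℚ_[p]) / n := by
    push_cast
    field_simp
  rw [heq, norm_div, hn1, div_one]
  exact hnorm

end Shift

/-! ### Reduced fractions and torsion points on the circle -/

section Circle

theorem coe_intCast_eq_zero (t : ℤ) : ((t : ℝ) : UnitAddCircle) = 0 :=
  (AddCircle.coe_eq_zero_iff 1).2 ⟨t, by simp⟩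

theorem norm_coe_le_abs (t : ℝ) : ‖(t : UnitAddCircle)‖ ≤ |t| := by
  rw [UnitAddCircle.norm_eq]
  simpa using round_le t 0

/-- Numerators matter only modulo `n` on the circle, so the range condition costs nothing there. -/
theorem exists_numerator_eq_coe_div {n : ℕ} (hn : n ≠ 0) {a : ℤ} (ha : Int.gcd a n = 1) :
    ∃ a' ∈ numerators n,
      (((a' : ℝ) / (n : ℝ) : ℝ) : UnitAddCircle) = (((a : ℝ) / (n : ℝ) : ℝ) : UnitAddCircle) := by
  have hn0 : (n : ℤ) ≠ 0 := by exact_mod_cast hn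
  have h1 := Int.emod_nonneg a hn0
  have h2 := Int.emod_lt_abs a hn0
  rw [Nat.abs_cast] at h2
  refine ⟨a % n, ⟨by omega, h2.le, by rwa [Int.gcd_emod]⟩, ?_⟩
  have hdecomp : (a : ℝ) = ((a % n : ℤ) : ℝ) + n * ((a / n : ℤ) : ℝ) := by
    exact_mod_cast (Int.emod_add_mul_ediv a n).symm
  have : (a : ℝ) / n = ((a % n : ℤ) : ℝ) / n + ((a / n : ℤ) : ℝ) := by
    have : (n : ℝ) ≠ 0 := by exact_mod_cast hn
    rw [hdecomp]
    field_simp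
  rw [this, AddCircle.coe_add, coe_intCast_eq_zero, add_zero]

theorem exists_numerator_eq_nsmul {n d : ℕ} (hn : n ≠ 0) (hd : d.Coprime n) {a : ℤ}
    (ha : a ∈ numerators n) :
    ∃ a' ∈ numerators n, (((a' : ℝ) / (n : ℝ) : ℝ) : UnitAddCircle) =
      d • (((a : ℝ) / (n : ℝ) : ℝ) : UnitAddCircle) := by
  have hgcd : Int.gcd (d * a) n = 1 := by
    rw [← Int.isCoprime_iff_gcd_eq_one]
    exact IsCoprime.mul_left (Nat.isCoprime_iff_coprime.2 hd)
      (Int.isCoprime_iff_gcd_eq_one.2 ha.2.2)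
  obtain ⟨a', ha', h⟩ := exists_numerator_eq_coe_div hn hgcd
  refine ⟨a', ha', h.trans ?_⟩
  rw [← AddCircle.coe_nsmul]
  congr 1
  push_cast
  rw [nsmul_eq_mul, mul_div_assoc]

/-- Points of the circle are close to reduced fractions with any given large denominator. -/
theorem eventually_forall_exists_circle_near {ε : ℝ} (hε : 0 < ε) :
    ∀ᶠ n : ℕ in atTop, ∀ x : UnitAddCircle,
      ∃ a ∈ numerators n, ‖x - (((a : ℝ) / (n : ℝ) : ℝ) : UnitAddCircle)‖ ≤ ε := by
  obtain ⟨C, hC⟩ := exists_nat_gt (1 / ε)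
  filter_upwards [eventually_mul_two_pow_card_primeFactors_le C, eventually_ne_atTop 0]
    with n hn hn0 x
  obtain ⟨t, rfl⟩ := QuotientAddGroup.mk_surjective x
  change ∃ a ∈ numerators n, ‖(t : UnitAddCircle) - (((a : ℝ) / (n : ℝ) : ℝ) : UnitAddCircle)‖ ≤ ε
  have hnpos : (0 : ℝ) < n := by exact_mod_cast Nat.pos_of_ne_zero hn0
  have ht : (t : UnitAddCircle) = (Int.fract t : ℝ) := by
    conv_lhs => rw [← Int.floor_add_fract t]
    rw [AddCircle.coe_add, coe_intCast_eq_zero, zero_add]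
  -- With step 1, a coprime numerator occurs within `2 ^ ω(n)` of `n * fract t`, and `2 ^ ω(n) ≤ ε *
  -- n`.
  obtain ⟨j, hj, hcj⟩ := exists_coprime_add_mul hn0 (Nat.coprime_one_left n) ⌊Int.fract t * n⌋₊
  rw [one_mul] at hcj
  obtain ⟨a, ha, hax⟩ := exists_numerator_eq_coe_div (a := ((⌊Int.fract t * n⌋₊ + j : ℕ) : ℤ)) hn0
    (by rwa [Int.gcd_natCast_natCast])
  refine ⟨a, ha, ?_⟩
  rw [hax, ht, ← AddCircle.coe_sub]
  refine (norm_coe_le_abs _).trans ?_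
  have hfl := Nat.floor_le (mul_nonneg (Int.fract_nonneg t) hnpos.le)
  have hlt := Nat.lt_floor_add_one (Int.fract t * n)
  have hj1 : (j : ℝ) + 1 ≤ 2 ^ n.primeFactors.card := by exact_mod_cast hj
  have hn' : (C : ℝ) * 2 ^ n.primeFactors.card ≤ n := by exact_mod_cast hn
  have hCε : 1 ≤ ε * C := by
    rw [div_lt_iff₀ hε] at hC
    linarith
  have hpow : (2 : ℝ) ^ n.primeFactors.card ≤ ε * n := by
    have h0 : (0 : ℝ) < 2 ^ n.primeFactors.card := by positivity
    nlinarith [mul_le_mul_of_nonneg_left hn' hε.le, mul_le_mul_of_nonneg_right hCε h0.le]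
  have hj0 : (0 : ℝ) ≤ j := Nat.cast_nonneg j
  have heq : Int.fract t - (((⌊Int.fract t * n⌋₊ + j : ℕ) : ℤ) : ℝ) / n =
      (Int.fract t * n - ⌊Int.fract t * n⌋₊ - j) / n := by
    push_cast
    field_simp
    ring
  rw [heq, abs_div, abs_of_pos hnpos, div_le_iff₀ hnpos, abs_le]
  constructor <;> linarith

theorem dense_setOf_exists_pow_nsmul_eq_zero {q : ℕ} (hq : 1 < q) :
    Dense {u : UnitAddCircle | ∃ m : ℕ, q ^ m • u = 0} := by
  rw [Metric.dense_iff]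
  intro x ε hε
  obtain ⟨t, rfl⟩ := QuotientAddGroup.mk_surjective x
  obtain ⟨m, hm⟩ := exists_pow_lt_of_lt_one hε (inv_lt_one_of_one_lt₀ (Nat.one_lt_cast (α := ℝ).2 hq))
  have hqm : (0 : ℝ) < (q : ℝ) ^ m := by positivity
  refine ⟨((⌊t * q ^ m⌋ / q ^ m : ℝ) : UnitAddCircle), ?_, m, ?_⟩
  · rw [Metric.mem_ball, dist_comm, dist_eq_norm]
    refine lt_of_le_of_lt ?_ hm
    refine (norm_coe_le_abs (t - ⌊t * q ^ m⌋ / q ^ m)).trans ?_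
    have h1 := Int.floor_le (t * q ^ m)
    have h2 := Int.lt_floor_add_one (t * q ^ m)
    have heq : t - ⌊t * q ^ m⌋ / q ^ m = (t * q ^ m - ⌊t * q ^ m⌋) / q ^ m := by field_simp
    rw [heq, abs_div, abs_of_pos hqm, inv_pow, div_le_iff₀ hqm, inv_mul_cancel₀ hqm.ne', abs_le]
    constructor <;> linarith
  · rw [← AddCircle.coe_nsmul, nsmul_eq_mul]
    push_cast
    rw [mul_div_cancel₀ _ hqm.ne', coe_intCast_eq_zero]

theorem exists_nsmul_eq {d : ℕ} (hd : d ≠ 0) (x : UnitAddCircle) : ∃ u, d • u = x := by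
  obtain ⟨t, rfl⟩ := QuotientAddGroup.mk_surjective x
  refine ⟨((t / d : ℝ) : UnitAddCircle), ?_⟩
  rw [← AddCircle.coe_nsmul, nsmul_eq_mul, mul_div_cancel₀ _ (Nat.cast_ne_zero.2 hd)]

instance instIsProbabilityMeasureUnitAddCircle :
    IsProbabilityMeasure (volume : Measure UnitAddCircle) :=
  ⟨UnitAddCircle.measure_univ⟩

end Circle

/-! ### Approximation sets in the product space -/

section Space

variable {ℓ k : ℕ} {p : Fin k → ℕ} [∀ i, Fact (p i).Prime]

instance instIsProbabilityMeasureMixedMeasure : IsProbabilityMeasure (mixedMeasure ℓ p) := by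
  unfold mixedMeasure
  infer_instance

instance instIsAddHaarMeasureMixedMeasure : (mixedMeasure ℓ p).IsAddHaarMeasure := by
  unfold mixedMeasure
  exact Measure.prod.instIsAddHaarMeasure _ _

instance instIsUnifLocDoublingMeasureMixedMeasure : IsUnifLocDoublingMeasure (mixedMeasure ℓ p) := by
  unfold mixedMeasure
  infer_instance

theorem mem_approxSet_iff {ψ : ℕ → ℝ} {n : ℕ} (hψ : 0 ≤ ψ n) (z : Space ℓ p) :
    z ∈ approxSet ℓ p ψ n ↔
      (∀ j, ∃ a ∈ numerators n, ‖z.1 j - (((a : ℝ) / (n : ℝ) : ℝ) : UnitAddCircle)‖ ≤ ψ n) ∧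
      ∀ i, ∃ b ∈ numerators n, ‖(z.2 i : ℚ_[p i]) - (b : ℚ_[p i]) / (n : ℚ_[p i])‖ ≤ ψ n := by
  simp only [approxSet, mixedNorm, mem_ofPred_eq, max_le_iff, pi_norm_le_iff_of_nonneg hψ]
  constructor
  · rintro ⟨a, b, ha, hb, h1, h2⟩
    exact ⟨fun j => ⟨a j, ha j, h1 j⟩, fun i => ⟨b i, hb i, h2 i⟩⟩
  · rintro ⟨h1, h2⟩
    choose a ha h1 using h1
    choose b hb h2 using h2
    exact ⟨a, b, ha, hb, h1, h2⟩

/-- Circle norms never exceed 1/2, and by the ultrametric inequality a fraction within `ψ n ≥ 1` of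
one p-adic integer is within `ψ n` of all of them. -/
theorem approxSet_eq_univ_of_one_le {ψ : ℕ → ℝ} {n : ℕ} (hψ : 1 ≤ ψ n)
    (h : (approxSet ℓ p ψ n).Nonempty) : approxSet ℓ p ψ n = univ := by
  have hψ0 : 0 ≤ ψ n := zero_le_one.trans hψ
  obtain ⟨z, hz⟩ := h
  rw [mem_approxSet_iff hψ0] at hz
  refine eq_univ_of_forall fun w => (mem_approxSet_iff hψ0 w).2
    ⟨fun j => ?_, fun i => ?_⟩
  · obtain ⟨a, ha, -⟩ := hz.1 j
    refine ⟨a, ha, le_trans ?_ hψ⟩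
    refine (AddCircle.norm_le_half_period 1 one_ne_zero).trans ?_
    norm_num
  · obtain ⟨b, hb, hzb⟩ := hz.2 i
    refine ⟨b, hb, ?_⟩
    have hwz : ‖((w.2 i - z.2 i : ℤ_[p i]) : ℚ_[p i])‖ ≤ ψ n := by
      rw [← PadicInt.norm_def]
      exact (PadicInt.norm_le_one _).trans hψ
    have := (Padic.nonarchimedean _ _).trans (max_le hwz hzb)
    rwa [PadicInt.coe_sub, sub_add_sub_cancel] at this

/-- The numerator is a p-adic unit while the denominator is not, so the fraction has norm above 1
and is far from every p-adic integer. -/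
theorem one_le_of_dvd_of_nonempty {ψ : ℕ → ℝ} {n : ℕ} (hψ : 0 ≤ ψ n) (hn : n ≠ 0)
    {i : Fin k} (hi : p i ∣ n) (h : (approxSet ℓ p ψ n).Nonempty) : 1 ≤ ψ n := by
  obtain ⟨z, hz⟩ := h
  obtain ⟨b, hb, hzb⟩ := ((mem_approxSet_iff hψ z).1 hz).2 i
  by_contra! hlt
  have hn1 : ‖(n : ℚ_[p i])‖ < 1 := by
    have : ‖(n : ℤ_[p i])‖ < 1 := by
      rw [PadicInt.norm_natCast_lt_one_iff]
      exact hi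
    simpa [PadicInt.norm_def] using this
  have hb1 : ‖(b : ℚ_[p i])‖ = 1 := by
    have : ‖(b : ℤ_[p i])‖ = 1 := by
      rw [PadicInt.norm_intCast_eq_one_iff]
      exact (Int.isCoprime_iff_gcd_eq_one.2 hb.2.2).of_isCoprime_of_dvd_right (by exact_mod_cast hi)
    simpa [PadicInt.norm_def] using this
  have hnq : (n : ℚ_[p i]) ≠ 0 := by exact_mod_cast hn
  have hle : ‖(b : ℚ_[p i]) / n‖ ≤ 1 := by
    have := Padic.nonarchimedean (z.2 i : ℚ_[p i]) (-((z.2 i : ℚ_[p i]) - b / n))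
    rw [norm_neg, neg_sub, add_sub_cancel] at this
    exact this.trans (max_le (z.2 i).2 (hzb.trans hlt.le))
  rw [norm_div, hb1, div_le_iff₀ (norm_pos_iff.2 hnq), one_mul] at hle
  exact hle.not_gt hn1

variable (ℓ p) in
/-- The points of the space all of whose coordinates are admissible fractions with denominator
`n`. -/
def centers (n : ℕ) : Set (Space ℓ p) :=
  (univ.pi fun _ => {x | ∃ a ∈ numerators n, x = (((a : ℝ) / (n : ℝ) : ℝ) : UnitAddCircle)}) ×ˢ
    (univ.pi fun i => {y : ℤ_[p i] | ∃ b ∈ numerators n, n * y = b})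

theorem mem_centers {n : ℕ} {c : Space ℓ p} : c ∈ centers ℓ p n ↔
    (∀ j, ∃ a ∈ numerators n, c.1 j = (((a : ℝ) / (n : ℝ) : ℝ) : UnitAddCircle)) ∧
      ∀ i, ∃ b ∈ numerators n, n * c.2 i = b := by
  simp [centers, mem_prod]

theorem finite_numerators (n : ℕ) : (numerators n).Finite :=
  (finite_Icc (-(n : ℤ)) n).subset fun _ ha => ⟨ha.1, ha.2.1⟩

theorem finite_centers {n : ℕ} (hn : n ≠ 0) : (centers ℓ p n).Finite := by
  refine Finite.prod (Finite.pi fun j => ?_) (Finite.pi fun i => ?_)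
  · refine ((finite_numerators n).image
      fun a : ℤ => (((a : ℝ) / (n : ℝ) : ℝ) : UnitAddCircle)).subset ?_
    rintro x ⟨a, ha, rfl⟩
    exact ⟨a, ha, rfl⟩
  · have hinj : Function.Injective fun y : ℤ_[p i] => (n : ℤ_[p i]) * y :=
      mul_right_injective₀ (Nat.cast_ne_zero.2 hn)
    refine (((finite_numerators n).image
      fun b : ℤ => (b : ℤ_[p i])).preimage hinj.injOn).subset ?_
    rintro y ⟨b, hb, hy⟩
    exact ⟨b, hb, hy.symm⟩

theorem dist_le_iff_forall {r : ℝ} (hr : 0 ≤ r) (z c : Space ℓ p) :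
    dist z c ≤ r ↔ (∀ j, ‖z.1 j - c.1 j‖ ≤ r) ∧ ∀ i, ‖z.2 i - c.2 i‖ ≤ r := by
  rw [Prod.dist_eq, max_le_iff, dist_pi_le_iff hr, dist_pi_le_iff hr]
  simp only [dist_eq_norm]

theorem mem_cthickening_centers_iff {n : ℕ} (hn : n ≠ 0) {r : ℝ} (hr : 0 ≤ r) (z : Space ℓ p) :
    z ∈ Metric.cthickening r (centers ℓ p n) ↔ ∃ c ∈ centers ℓ p n,
      (∀ j, ‖z.1 j - c.1 j‖ ≤ r) ∧ ∀ i, ‖z.2 i - c.2 i‖ ≤ r := by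
  rw [(finite_centers hn).isCompact.cthickening_eq_biUnion_closedBall hr]
  simp only [mem_iUnion, Metric.mem_closedBall, exists_prop, dist_le_iff_forall hr]

theorem exists_padicInt_eq_div {q n : ℕ} [Fact q.Prime] (hn : ¬ q ∣ n) (b : ℤ) :
    ∃ c : ℤ_[q], n * c = b ∧ (c : ℚ_[q]) = (b : ℚ_[q]) / (n : ℚ_[q]) := by
  have hunit : IsUnit (n : ℤ_[q]) := by
    rw [PadicInt.isUnit_iff, PadicInt.norm_natCast_eq_one_iff]
    exact ((Fact.out : q.Prime).coprime_iff_not_dvd).2 hn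
  obtain ⟨c, hc⟩ := hunit.dvd (a := (b : ℤ_[q]))
  refine ⟨c, hc.symm, ?_⟩
  have hn0 : (n : ℚ_[q]) ≠ 0 := Nat.cast_ne_zero.2 fun h => hn (h ▸ dvd_zero q)
  rw [eq_div_iff hn0, mul_comm]
  exact_mod_cast (congrArg (fun y : ℤ_[q] => (y : ℚ_[q])) hc).symm

/-- Here `n` is a unit in each `ℤ_[p i]`, so the fractions are points of the space itself. -/
theorem approxSet_eq_cthickening {ψ : ℕ → ℝ} {n : ℕ} (hψ : 0 ≤ ψ n) (hn : n ≠ 0)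
    (hp : ∀ i, ¬ p i ∣ n) : approxSet ℓ p ψ n = Metric.cthickening (ψ n) (centers ℓ p n) := by
  ext z
  rw [mem_approxSet_iff hψ, mem_cthickening_centers_iff hn hψ]
  constructor
  · rintro ⟨h1, h2⟩
    choose a ha h1 using h1
    choose b hb h2 using h2
    choose c hc hcb using fun i => exists_padicInt_eq_div (hp i) (b i)
    refine ⟨(fun j => (((a j : ℝ) / (n : ℝ) : ℝ) : UnitAddCircle), c),
      mem_centers.2 ⟨fun j => ⟨a j, ha j, rfl⟩, fun i => ⟨b i, hb i, hc i⟩⟩, h1, fun i => ?_⟩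
    rw [PadicInt.norm_def, PadicInt.coe_sub, hcb]
    exact h2 i
  · rintro ⟨c, hc, h1, h2⟩
    rw [mem_centers] at hc
    refine ⟨fun j => ?_, fun i => ?_⟩
    · obtain ⟨a, ha, hca⟩ := hc.1 j
      exact ⟨a, ha, hca ▸ h1 j⟩
    · obtain ⟨b, hb, hcb⟩ := hc.2 i
      obtain ⟨c', hc', hcb'⟩ := exists_padicInt_eq_div (hp i) b
      refine ⟨b, hb, ?_⟩
      have hn0 : (n : ℤ_[p i]) ≠ 0 := Nat.cast_ne_zero.2 hn
      have : c.2 i = c' := mul_left_cancel₀ hn0 (hcb.trans hc'.symm)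
      rw [← hcb', ← this, ← PadicInt.coe_sub, ← PadicInt.norm_def]
      exact h2 i

theorem eventually_approxSet_eq_univ {ε : ℝ} (hε : 0 < ε) (ψ : ℕ → ℝ) :
    ∀ᶠ n : ℕ in atTop, (∀ i, ¬ p i ∣ n) → ε ≤ ψ n → approxSet ℓ p ψ n = univ := by
  filter_upwards [eventually_forall_exists_circle_near hε,
    eventually_all.2 fun i => eventually_forall_exists_padic_near (p := p i) hε]
    with n hcircle hpadic hp hψ
  refine eq_univ_of_forall fun z => (mem_approxSet_iff (hε.le.trans hψ) z).2
    ⟨fun j => ?_, fun i => ?_⟩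
  · obtain ⟨a, ha, h⟩ := hcircle (z.1 j)
    exact ⟨a, ha, h.trans hψ⟩
  · obtain ⟨b, hb, h⟩ := hpadic i (hp i) (z.2 i)
    exact ⟨b, hb, h.trans hψ⟩

/-! ### The expanding maps -/

/-- Multiplication by `q ^ m` on the circles and the `m`-fold digit shift on the `p`-adic
integers. -/
def expand (q m : ℕ) (z : Space ℓ p) : Space ℓ p :=
  (fun j => q ^ m • z.1 j, fun i => shift m (z.2 i))

theorem continuous_expand (q m : ℕ) : Continuous (expand q m : Space ℓ p → Space ℓ p) := by
  refine Continuous.prodMk (continuous_pi fun j => ?_) (continuous_pi fun i => ?_)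
  · fun_prop
  · exact (continuous_shift m).comp (by fun_prop)

theorem measurePreserving_expand {q : ℕ} (hq : q ≠ 0) (m : ℕ) :
    MeasurePreserving (expand q m) (mixedMeasure ℓ p) (mixedMeasure ℓ p) := by
  refine measurePreserving_of_exists_add _ (continuous_expand q m).measurable fun z => ?_
  choose u hu using fun j => exists_nsmul_eq (pow_ne_zero m hq) (z.1 j)
  refine ⟨(u, fun i => (p i : ℤ_[p i]) ^ m * z.2 i), fun x => Prod.ext ?_ ?_⟩
  · ext j
    simp [expand, hu]
  · ext i : 1
    exact shift_add_pow_mul m (x.2 i) (z.2 i)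

variable (ℓ p) in
/-- The translations that are, up to small sets, absorbed by `expand q m` for large `m`. -/
def absorbed (q : ℕ) : Set (Space ℓ p) :=
  (univ.pi fun _ => {u : UnitAddCircle | ∃ m : ℕ, q ^ m • u = 0}) ×ˢ
    (univ.pi fun i => range (Nat.cast : ℕ → ℤ_[p i]))

theorem dense_absorbed {q : ℕ} (hq : 1 < q) : Dense (absorbed ℓ p q) :=
  (dense_pi univ fun _ _ => dense_setOf_exists_pow_nsmul_eq_zero hq).prod
    (dense_pi univ fun _ _ => PadicInt.denseRange_natCast)

/-- Torsion coordinates are annihilated once `m` is large; the p-adic coordinates contribute only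
their carry sets, handled by a union bound. -/
theorem tendsto_measure_expand_add_ne {q : ℕ} {g : Space ℓ p} (hg : g ∈ absorbed ℓ p q) :
    Tendsto (fun m => mixedMeasure ℓ p {x | expand q m (g + x) ≠ expand q m x}) atTop (𝓝 0) := by
  obtain ⟨h1, h2⟩ := hg
  rw [mem_univ_pi] at h1 h2
  choose m₀ hm₀ using h1
  choose N hN using h2
  have hev : MeasurePreserving (fun x : Space ℓ p => x.2) (mixedMeasure ℓ p)
      (Measure.pi fun i : Fin k => padicHaar (p i)) := measurePreserving_snd
  have hbad : ∀ m i, mixedMeasure ℓ p {x | shift m ((N i : ℤ_[p i]) + x.2 i) ≠ shift m (x.2 i)} =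
      padicHaar (p i) {y | shift m ((N i : ℤ_[p i]) + y) ≠ shift m y} := by
    intro m i
    have hopen : IsOpen {y : ℤ_[p i] | shift m ((N i : ℤ_[p i]) + y) ≠ shift m y} :=
      isOpen_ne_fun ((continuous_shift m).comp (continuous_const_add _)) (continuous_shift m)
    exact (((measurePreserving_eval (fun i => padicHaar (p i)) i).comp hev).measure_preimage
      hopen.measurableSet.nullMeasurableSet)
  have hsub : ∀ᶠ m in atTop, mixedMeasure ℓ p {x | expand q m (g + x) ≠ expand q m x} ≤
      ∑ i, padicHaar (p i) {y | shift m ((N i : ℤ_[p i]) + y) ≠ shift m y} := by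
    filter_upwards [eventually_all.2 fun j => eventually_ge_atTop (m₀ j)] with m hm
    simp_rw [← hbad]
    refine le_trans (measure_mono fun x hx => ?_) (measure_iUnion_fintype_le _ _)
    rw [mem_iUnion]
    by_contra! hcon
    refine hx (Prod.ext ?_ ?_)
    · ext j
      have : q ^ m • g.1 j = 0 := by
        obtain ⟨d, hd⟩ := Nat.exists_eq_add_of_le (hm j)
        rw [hd, pow_add, mul_comm, mul_nsmul', hm₀ j, nsmul_zero]
      simp [expand, this]
    · ext i : 1
      have := hcon i
      rw [mem_ofPred_eq, not_not, hN i] at this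
      exact this
  refine tendsto_of_tendsto_of_tendsto_of_le_of_le' tendsto_const_nhds ?_
    (Eventually.of_forall fun _ => zero_le) hsub
  rw [← Finset.sum_const_zero (s := (Finset.univ : Finset (Fin k)))]
  exact tendsto_finsetSum _ fun i _ => tendsto_padicHaar_shift_natCast_add_ne (N i)

/-- `expand q m` maps small neighbourhoods of the admissible fractions to neighbourhoods of
comparable size. -/
theorem expand_mem_cthickening {q m n : ℕ} (hn : n ≠ 0) (hq : q.Coprime n) {r M : ℝ} (hr : 0 ≤ r)
    (hqM : (q : ℝ) ^ m ≤ M) (hpM : ∀ i, (p i : ℝ) ^ m ≤ M) (hM : M * r ≤ 1) {z : Space ℓ p}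
    (hz : z ∈ Metric.cthickening r (centers ℓ p n)) :
    expand q m z ∈ Metric.cthickening (M * r) (centers ℓ p n) := by
  have hM0 : 0 ≤ M := le_trans (by positivity) hqM
  rw [mem_cthickening_centers_iff hn hr] at hz
  rw [mem_cthickening_centers_iff hn (mul_nonneg hM0 hr)]
  obtain ⟨c, hc, h1, h2⟩ := hz
  rw [mem_centers] at hc
  obtain ⟨hc1, hc2⟩ := hc
  have key : ∀ i, ∃ b' ∈ numerators n, ∃ c' : ℤ_[p i], n * c' = b' ∧
      ‖shift m (z.2 i) - c'‖ = p i ^ m * ‖z.2 i - c.2 i‖ := by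
    intro i
    obtain ⟨b, hb, hcb⟩ := hc2 i
    have hpos : (0 : ℝ) < (p i : ℝ) ^ m :=
      pow_pos (Nat.cast_pos.2 (Fact.out : (p i).Prime).pos) m
    -- `M * r ≤ 1` brings the point within `p ^ (-m)` of the fraction, so both have the same lowest
    -- `m` digits.
    refine exists_numerator_shift hb hcb ((h2 i).trans ?_)
    rw [← one_div, le_div_iff₀ hpos]
    calc r * (p i : ℝ) ^ m ≤ r * M := mul_le_mul_of_nonneg_left (hpM i) hr
      _ ≤ 1 := by rwa [mul_comm]
  choose b' hb' c' hc' hcn using key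
  refine ⟨(fun j => q ^ m • c.1 j, c'), mem_centers.2 ⟨fun j => ?_, fun i => ⟨b' i, hb' i, hc' i⟩⟩,
    fun j => ?_, fun i => ?_⟩
  · obtain ⟨a, ha, hca⟩ := hc1 j
    obtain ⟨a', ha', h⟩ := exists_numerator_eq_nsmul hn (hq.pow_left m) ha
    exact ⟨a', ha', by rw [h, ← hca]⟩
  · change ‖q ^ m • z.1 j - q ^ m • c.1 j‖ ≤ M * r
    rw [← nsmul_sub]
    refine (norm_nsmul_le (n := q ^ m) (a := z.1 j - c.1 j)).trans ?_
    push_cast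
    exact mul_le_mul hqM (h1 j) (norm_nonneg _) hM0
  · change ‖shift m (z.2 i) - c' i‖ ≤ M * r
    rw [hcn]
    exact mul_le_mul (hpM i) (h2 i) (norm_nonneg _) hM0

/-! ### Almost invariance and the zero-one law -/

variable (ℓ p) in
/-- The points lying in the `r n`-neighbourhood of the admissible fractions with denominator `n`
for infinitely many `n` divisible by no `p i`. -/
def wellApprox (r : ℕ → ℝ) : Set (Space ℓ p) :=
  blimsup (fun n => Metric.cthickening (r n) (centers ℓ p n)) atTop
    fun n => n ≠ 0 ∧ ∀ i, ¬ p i ∣ n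

theorem mem_wellApprox {r : ℕ → ℝ} {z : Space ℓ p} : z ∈ wellApprox ℓ p r ↔
    ∃ᶠ n in atTop, (n ≠ 0 ∧ ∀ i, ¬ p i ∣ n) ∧ z ∈ Metric.cthickening (r n) (centers ℓ p n) := by
  rw [wellApprox, ← Nat.cofinite_eq_atTop, cofinite.blimsup_set_eq, frequently_cofinite_iff_infinite]
  rfl

theorem measurableSet_wellApprox (r : ℕ → ℝ) : MeasurableSet (wellApprox ℓ p r) :=
  MeasurableSet.measurableSet_blimsup fun _ _ => Metric.isClosed_cthickening.measurableSet

/-- Expansion gives an inclusion up to the factor `M`, which `blimsup_cthickening_mul_ae_eq` removes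
almost everywhere. Measure preservation turns the inclusion into equality. -/
theorem preimage_expand_wellApprox_ae_eq {i₀ : Fin k} {r : ℕ → ℝ} (hr0 : ∀ n, 0 ≤ r n)
    (hr : Tendsto r atTop (𝓝 0)) (m : ℕ) :
    expand (p i₀) m ⁻¹' wellApprox ℓ p r =ᵐ[mixedMeasure ℓ p] wellApprox ℓ p r := by
  set M : ℝ := ∑ i, (p i : ℝ) ^ m with hMdef
  have hpM : ∀ i, (p i : ℝ) ^ m ≤ M := fun i =>
    Finset.single_le_sum (f := fun i => (p i : ℝ) ^ m) (fun _ _ => by positivity)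
      (Finset.mem_univ i)
  have hprime : (p i₀).Prime := Fact.out
  have hM : 0 < M := lt_of_lt_of_le (pow_pos (Nat.cast_pos.2 hprime.pos) m) (hpM i₀)
  have hmp := measurePreserving_expand (ℓ := ℓ) (p := p) hprime.ne_zero m
  have hscale : wellApprox ℓ p (fun n => M * r n) =ᵐ[mixedMeasure ℓ p] wellApprox ℓ p r :=
    blimsup_cthickening_mul_ae_eq _ _ _ hM r hr
  have hsub : wellApprox ℓ p r ⊆ expand (p i₀) m ⁻¹' wellApprox ℓ p (fun n => M * r n) := by
    intro z hz
    rw [mem_preimage, mem_wellApprox]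
    rw [mem_wellApprox] at hz
    have hsmall : ∀ᶠ n in atTop, M * r n ≤ 1 := by
      have := hr.const_mul M
      rw [mul_zero] at this
      exact (this.eventually_lt_const one_pos).mono fun _ h => h.le
    refine (hz.and_eventually hsmall).mono fun n hn => ⟨hn.1.1, ?_⟩
    exact expand_mem_cthickening hn.1.1.1 ((hprime.coprime_iff_not_dvd).2 (hn.1.1.2 i₀)) (hr0 n)
      (hpM i₀) hpM hn.2 hn.1.2
  have hle : wellApprox ℓ p r ≤ᵐ[mixedMeasure ℓ p] expand (p i₀) m ⁻¹' wellApprox ℓ p r :=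
    hsub.eventuallyLE.trans (hmp.quasiMeasurePreserving.preimage_ae_eq hscale).le
  refine (ae_eq_of_ae_subset_of_measure_ge hle ?_
    (measurableSet_wellApprox r).nullMeasurableSet (measure_ne_top _ _)).symm
  exact (hmp.measure_preimage (measurableSet_wellApprox r).nullMeasurableSet).le

theorem measure_wellApprox_eq_zero_or_one (hk : 1 ≤ k) {r : ℕ → ℝ} (hr0 : ∀ n, 0 ≤ r n)
    (hr : Tendsto r atTop (𝓝 0)) :
    mixedMeasure ℓ p (wellApprox ℓ p r) = 0 ∨ mixedMeasure ℓ p (wellApprox ℓ p r) = 1 := by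
  -- The circle multiplier must be prime to every relevant `n`; any `p i` serves, and `k ≥ 1`
  -- provides one.
  have hprime : (p ⟨0, hk⟩).Prime := Fact.out
  have h := eventuallyConst_of_preimage_ae_eq (mixedMeasure ℓ p) (dense_absorbed hprime.one_lt)
    (fun g hg => tendsto_measure_expand_add_ne hg) (measurableSet_wellApprox r)
    (preimage_expand_wellApprox_ae_eq hr0 hr)
  rcases eventuallyConst_set'.1 h with h | h
  · exact Or.inl (by rw [measure_congr h, measure_empty])
  · exact Or.inr (by rw [measure_congr h, measure_univ])

theorem mem_limsupSet_iff {ψ : ℕ → ℝ} {z : Space ℓ p} :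
    z ∈ limsupSet ℓ p ψ ↔ ∃ᶠ n in atTop, 1 ≤ n ∧ z ∈ approxSet ℓ p ψ n :=
  Nat.frequently_atTop_iff_infinite.symm

end Space

end MixedApprox

open MixedApprox Filter Topology in
theorem lemma1 (ℓ k : ℕ) (hk : 1 ≤ k) (p : Fin k → ℕ) [∀ i, Fact (p i).Prime]
    (ψ : ℕ → ℝ) (hψ : ∀ n : ℕ, 1 ≤ n → 0 ≤ ψ n) :
    MixedApprox.mixedMeasure ℓ p (MixedApprox.limsupSet ℓ p ψ) = 0 ∨
      MixedApprox.mixedMeasure ℓ p (MixedApprox.limsupSet ℓ p ψ) = 1 := by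
  by_cases hfull : ∃ᶠ n in atTop, 1 ≤ n ∧ approxSet ℓ p ψ n = Set.univ
  · right
    have : limsupSet ℓ p ψ = Set.univ := Set.eq_univ_of_forall fun z =>
      mem_limsupSet_iff.2 (hfull.mono fun n hn => ⟨hn.1, hn.2 ▸ Set.mem_univ z⟩)
    rw [this, measure_univ]
  rw [not_frequently] at hfull
  classical
  -- Zeroing the radii at irrelevant `n` makes them nonnegative and convergent to 0 along all of
  -- `ℕ`; those `n` are excluded from `wellApprox` anyway.
  set r : ℕ → ℝ := fun n => if 1 ≤ n ∧ ∀ i, ¬ p i ∣ n then ψ n else 0 with hrdef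
  have hr0 : ∀ n, 0 ≤ r n := by
    intro n
    simp only [hrdef]
    split_ifs with h
    exacts [hψ n h.1, le_rfl]
  have hr : Tendsto r atTop (𝓝 0) := by
    refine tendsto_order.2 ⟨fun a ha => Eventually.of_forall fun n => ha.trans_le (hr0 n),
      fun ε hε => ?_⟩
    filter_upwards [hfull, eventually_approxSet_eq_univ (ℓ := ℓ) (p := p) hε ψ] with n h1 h2
    simp only [hrdef]
    split_ifs with h
    · by_contra! hle
      exact h1 ⟨h.1, h2 h.2 hle⟩
    · exact hε
  have heq : limsupSet ℓ p ψ = wellApprox ℓ p r := by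
    ext z
    rw [mem_limsupSet_iff, mem_wellApprox]
    refine frequently_congr (hfull.mono fun n hn => ?_)
    rw [← Nat.one_le_iff_ne_zero]
    have hcop : 1 ≤ n → (∀ i, ¬ p i ∣ n) →
        approxSet ℓ p ψ n = Metric.cthickening (r n) (centers ℓ p n) := fun h1 hp => by
      rw [approxSet_eq_cthickening (hψ n h1) (by omega) hp]
      simp only [hrdef]
      rw [if_pos ⟨h1, hp⟩]
    constructor
    · rintro ⟨h1, hz⟩
      -- If some `p i` divided `n`, a nonempty approximation set would be the whole space, contrary
      -- to `hn`.
      have hp : ∀ i, ¬ p i ∣ n := fun i hi => hn ⟨h1, approxSet_eq_univ_of_one_le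
        (one_le_of_dvd_of_nonempty (hψ n h1) (by omega) hi ⟨z, hz⟩) ⟨z, hz⟩⟩
      exact ⟨⟨h1, hp⟩, hcop h1 hp ▸ hz⟩
    · rintro ⟨⟨h1, hp⟩, hz⟩
      exact ⟨h1, (hcop h1 hp).symm ▸ hz⟩
  rw [heq]
  exact measure_wellApprox_eq_zero_or_one hk hr0 hr

end
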